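/- Let $K$ be a number field, $C/K$ a smooth, proper, (geometrically) irreducible curve with a rational base point $Q\in C(K)$, $J$ its Jacobian, $\iota:C\to J$, $\iota(P)=[P-Q]$ the Abel–Jacobi map, and $\psi:C\to\mathbb P^1$ a morphism defined over $K$. Put $H=\{P\in C(K):\psi(P)\in\mathbb P^1(\mathbb Q)\}$. Let $L\le J(K)$ be a subgroup of finite index $N$, and let $p_0,\dots,p_b$ be rational primes such that for $0\le i\le b$: (i) $p_i$ is unramified in $\mathcal O_K$; (ii) for every prime $\mathfrak p\mid p_i$ of $\mathcal O_K$ the curve $C$ has good reduction at $\mathfrak p$, and $\psi$ extends to a morphism to $\mathbb P^1$ of a smooth proper model of $C$ over the local ring at $\mathfrak p$; on the special fibre it induces the reduced map $\overline{\psi^{\mathfrak p}}$; (iii) $\#\prod_{\mathfrak p\mid p_i}J(k_{\mathfrak p})$ is coprime to $N$, where $k_{\mathfrak p}$ is the residue field at $\mathfrak p$ and $J(k_{\mathfrak p})$ denotes the $k_{\mathfrak p}$-points of the Jacobian of the reduced curve. Let $\mathrm{red}_{p_i}$ denote the reduction maps $C(K)\to\prod_{\mathfrak p\mid p_i}C(k_{\mathfrak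 p})$ and $J(K)\to\prod_{\mathfrak p\mid p_i}J(k_{\mathfrak p})$ (the latter a homomorphism), let $\iota$ also denote the Abel–Jacobi map $\prod_{\mathfrak p\mid p_i}C(k_{\mathfrak p})\to\prod_{\mathfrak p\mid p_i}J(k_{\mathfrak p})$ with base point $\mathrm{red}_{p_i}(Q)$, and let $$\mathcal G_i=\Big\{\mathcal P\in\prod_{\mathfrak p\mid p_i}C(k_{\mathfrak p}) : \overline{\psi^{\mathfrak p}}(\mathcal P_{\mathfrak p})=\overline{\psi^{\mathfrak q}}(\mathcal P_{\mathfrak q})\in\mathbb P^1(\mathbb F_{p_i})\ \text{ for all }\mathfrak p,\mathfrak q\mid p_i\Big\}.$$ Put $L_0=L\cap\ker(\mathrm{red}_{p_0})$ and $L_i=L_{i-1}\cap\ker(\mathrm{red}_{p_i})$ for $1\le i\le b$. For $\mathcal P\in\mathcal G_0$ let $$W_{0,\mathcal P}=\{w\in L/L_0:\mathrm{red}_{p_0}(w)=\iota(\mathcal P)\},$$ and for $1\le i\le b$ let $W_{i,\mathcal P}\subseteq L/L_i$ be the set of classes of $w+l$, where $w\in L$ represents an element of $W_{i-1,\mathcal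 P}\subseteq L/L_{i-1}$, $l\in L_{i-1}$, and $\mathrm{red}_{p_i}(w+l)\in\iota(\mathcal G_i)$. If $\mathcal P\in\mathcal G_0$ and $W_{b,\mathcal P}=\emptyset$, then no $P\in H$ satisfies $\mathrm{red}_{p_0}(P)=\mathcal P$. -/

import Mathlib

open CategoryTheory CategoryTheory.Limits AlgebraicGeometry

noncomputable section

/-! ### Curves over a field, divisors and the degree-zero divisor class group -/

/-- A smooth proper integral curve over the field `k`. -/
structure Curve (k : Type) [Field k] where
  /-- the underlying scheme -/
  X : Scheme.{0}
  /-- the structure morphism -/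
  str : X ⟶ Spec (.of k)
  [integral : IsIntegral X]
  [proper : IsProper str]
  [smooth : SmoothOfRelativeDimension 1 str]

namespace Curve

attribute [instance] Curve.integral Curve.proper Curve.smooth

variable {k : Type} [Field k] (C : Curve k)

instance isLocallyNoetherian : IsLocallyNoetherian C.X :=
  LocallyOfFiniteType.isLocallyNoetherian C.str

/-- The `k`-rational points `C(k)`. -/
@[ext]
structure Point where
  /-- the underlying section of the structure morphism -/
  hom : Spec (.of k) ⟶ C.X
  comp_str : hom ≫ C.str = 𝟙 _

/-- The closed points of the curve, i.e. its prime divisors. -/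
abbrev ClosedPoint : Type := {x : C.X // IsClosed ({x} : Set C.X)}

/-- Divisors on `C`: finite formal sums of closed points. -/
abbrev Div : Type := C.ClosedPoint →₀ ℤ

/-- The degree `∑ n_x [κ(x) : k]` of a divisor. -/
def degree : C.Div →+ ℤ :=
  Finsupp.liftAddHom fun x => AddMonoidHom.mulRight (C.str.residueDegree x.1 : ℤ)

/-- The principal divisors: the divisors of the nonzero rational functions. -/
def principal : AddSubgroup C.Div where
  carrier := {D | ∃ f : C.X.functionField, f ≠ 0 ∧ ∀ x, D x = Scheme.ord f x.1}
  zero_mem' := by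
    refine ⟨1, one_ne_zero, fun x => ?_⟩
    have h := Scheme.ord_mul (x := x.1) (one_ne_zero (α := C.X.functionField)) one_ne_zero
    simp only [mul_one] at h
    simp only [Finsupp.coe_zero, Pi.zero_apply]
    omega
  add_mem' := by
    rintro D E ⟨f, hf, hD⟩ ⟨g, hg, hE⟩
    exact ⟨f * g, mul_ne_zero hf hg, fun x => by
      rw [Finsupp.add_apply, hD, hE, Scheme.ord_mul hf hg]⟩
  neg_mem' := by
    rintro D ⟨f, hf, hD⟩
    refine ⟨f⁻¹, inv_ne_zero hf, fun x => ?_⟩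
    have h := Scheme.ord_mul (x := x.1) hf (inv_ne_zero hf)
    have h' := Scheme.ord_mul (x := x.1) (one_ne_zero (α := C.X.functionField)) one_ne_zero
    rw [mul_inv_cancel₀ hf] at h
    simp only [mul_one] at h'
    rw [Finsupp.neg_apply, hD]
    omega

/-- The divisors of degree zero. -/
abbrev Div0 : AddSubgroup C.Div := C.degree.ker

/-- The group `Pic⁰(C)` of divisor classes of degree zero. For a curve with a rational point, this
is the group `J(k)` of rational points of the Jacobian `J` of `C`. -/
abbrev Jac : Type := C.Div0 ⧸ C.principal.addSubgroupOf C.Div0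

/-- The class of a divisor of degree zero. -/
def cls : C.Div0 →+ C.Jac := QuotientAddGroup.mk' _

variable {C}

theorem Point.isClosed_apply (P : C.Point) (s : Spec (.of k)) :
    IsClosed ({P.hom s} : Set C.X) := by
  have : IsClosedImmersion (P.hom ≫ C.str) := by rw [P.comp_str]; infer_instance
  have : IsClosedImmersion P.hom := IsClosedImmersion.of_comp P.hom C.str
  have : IsClosed ({s} : Set (Spec (.of k))) := by
    rw [Set.eq_univ_of_forall (s := {s}) fun x => Subsingleton.elim (α := PrimeSpectrum k) x s]
    exact isClosed_univ
  simpa only [Set.image_singleton] using P.hom.isClosedEmbedding.isClosedMap _ this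

theorem Point.residueDegree_apply (P : C.Point) (s : Spec (.of k)) :
    C.str.residueDegree (P.hom s) = 1 := by
  have h₁ : Function.Bijective ((P.hom ≫ C.str).residueFieldMap s).hom := by
    have h : IsIso (P.hom ≫ C.str) := by rw [P.comp_str]; infer_instance
    exact ConcreteCategory.bijective_of_isIso ((P.hom ≫ C.str).residueFieldMap s)
  rw [Scheme.residueFieldMap_comp] at h₁
  have hs : Function.Surjective (C.str.residueFieldMap (P.hom s)).hom := by
    intro a
    obtain ⟨c, hc⟩ := h₁.2 ((P.hom.residueFieldMap s).hom a)
    exact ⟨c, (P.hom.residueFieldMap s).hom.injective hc⟩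
  let _ := (C.str.residueFieldMap (P.hom s)).hom.toAlgebra
  have := (AlgEquiv.ofBijective (Algebra.ofId
    ((Spec (.of k)).residueField (C.str (P.hom s))) (C.X.residueField (P.hom s)))
    ⟨(C.str.residueFieldMap (P.hom s)).hom.injective, hs⟩).toLinearEquiv.finrank_eq
  rw [CommSemiring.finrank_self] at this
  exact this.symm

/-- The closed point of `C` underlying a rational point. -/
def Point.toClosedPoint (P : C.Point) : C.ClosedPoint :=
  ⟨P.hom (IsLocalRing.closedPoint k), P.isClosed_apply _⟩

theorem Point.residueDegree_eq_one (P : C.Point) :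
    C.str.residueDegree P.toClosedPoint.1 = 1 :=
  P.residueDegree_apply _

/-- The Abel-Jacobi map `P ↦ [P - Q]` with base point `Q`. -/
def abelJacobi (Q P : C.Point) : C.Jac :=
  C.cls ⟨Finsupp.single P.toClosedPoint 1 - Finsupp.single Q.toClosedPoint 1, by
    rw [AddMonoidHom.mem_ker, map_sub, degree, Finsupp.liftAddHom_apply_single,
      Finsupp.liftAddHom_apply_single]
    simp [Point.residueDegree_eq_one]⟩

end Curve

/-! ### Primes of a number field and models with good reduction -/

variable {K : Type} [Field K] [NumberField K]

open NumberField IsDedekindDomain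

/-- The primes of `𝓞 K` above the rational prime `p`. -/
abbrev PrimesAbove (K : Type) [Field K] [NumberField K] (p : ℕ) : Type :=
  {𝔭 : HeightOneSpectrum (𝓞 K) // (p : 𝓞 K) ∈ 𝔭.asIdeal}

/-- The local ring of `𝓞 K` at `𝔭`, as the subring of `𝔭`-integral elements of `K`. -/
abbrev LocalInt (𝔭 : HeightOneSpectrum (𝓞 K)) : ValuationSubring K :=
  (𝔭.valuation K).valuationSubring

/-- The residue field `k_𝔭`. -/
abbrev ResField (𝔭 : HeightOneSpectrum (𝓞 K)) : Type :=
  IsLocalRing.ResidueField (LocalInt 𝔭)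

/-- `Spec K ⟶ Spec 𝓞_{K,𝔭}`. -/
abbrev specGeneric (𝔭 : HeightOneSpectrum (𝓞 K)) :
    Spec (.of K) ⟶ Spec (.of (LocalInt 𝔭)) :=
  Spec.map (CommRingCat.ofHom (algebraMap (LocalInt 𝔭) K))

/-- `Spec k_𝔭 ⟶ Spec 𝓞_{K,𝔭}`. -/
abbrev specSpecial (𝔭 : HeightOneSpectrum (𝓞 K)) :
    Spec (.of (ResField 𝔭)) ⟶ Spec (.of (LocalInt 𝔭)) :=
  Spec.map (CommRingCat.ofHom (IsLocalRing.residue (LocalInt 𝔭)))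

/-- A model witnessing that `C` has good reduction at `𝔭`: a smooth proper scheme over the local
ring at `𝔭` whose generic fibre is `C` and whose special fibre is again a curve. -/
structure GoodModel (C : Curve K) (𝔭 : HeightOneSpectrum (𝓞 K)) where
  /-- the total space -/
  X : Scheme.{0}
  /-- the structure morphism -/
  str : X ⟶ Spec (.of (LocalInt 𝔭))
  /-- the inclusion of the generic fibre -/
  gen : C.X ⟶ X
  [proper : IsProper str]
  [smooth : SmoothOfRelativeDimension 1 str]
  isPullback : IsPullback gen C.str str (specGeneric 𝔭)
  [integral_special : IsIntegral (pullback str (specSpecial 𝔭))]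

namespace GoodModel

attribute [instance] GoodModel.proper GoodModel.smooth GoodModel.integral_special

variable {C : Curve K} {𝔭 : HeightOneSpectrum (𝓞 K)} (M : GoodModel C 𝔭)

/-- The reduction of the curve: the special fibre of the model. -/
def special : Curve (ResField 𝔭) where
  X := pullback M.str (specSpecial 𝔭)
  str := pullback.snd M.str (specSpecial 𝔭)
  integral := M.integral_special
  proper := inferInstance
  smooth := (smoothOfRelativeDimension_isStableUnderBaseChange 1).of_isPullback
    (IsPullback.of_hasPullback M.str (specSpecial 𝔭)) M.smooth

/-- The inclusion of the special fibre in the model. -/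
def inclSpecial : M.special.X ⟶ M.X := pullback.fst M.str (specSpecial 𝔭)

theorem exists_lift (P : C.Point) : ∃ s : Spec (.of (LocalInt 𝔭)) ⟶ M.X,
    specGeneric 𝔭 ≫ s = P.hom ≫ M.gen ∧ s ≫ M.str = 𝟙 _ := by
  have hsq : CommSq (P.hom ≫ M.gen)
      (Spec.map (CommRingCat.ofHom (algebraMap (LocalInt 𝔭) K))) M.str (𝟙 _) :=
    ⟨by rw [Category.assoc, M.isPullback.w, ← Category.assoc, P.comp_str, Category.id_comp,
      Category.comp_id]⟩
  have hV : ValuativeCriterion M.str := by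
    have h := M.proper
    rw [IsProper.eq_valuativeCriterion] at h
    exact h.1.1.1
  obtain ⟨⟨l, h₁, h₂⟩⟩ := (hV.existence
    { R := LocalInt 𝔭, K := K, i₁ := P.hom ≫ M.gen, i₂ := 𝟙 _, commSq := hsq }).exists_lift
  exact ⟨l, h₁, h₂⟩

/-- The extension of a rational point of `C` to a section of the model; it exists by the valuative
criterion of properness, and is unique since the model is separated. -/
def lift (P : C.Point) : Spec (.of (LocalInt 𝔭)) ⟶ M.X := (M.exists_lift P).choose

theorem lift_str (P : C.Point) : M.lift P ≫ M.str = 𝟙 _ := (M.exists_lift P).choose_spec.2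

/-- The reduction map `red_𝔭 : C(K) → C(k_𝔭)`. -/
def redPoint (P : C.Point) : M.special.Point :=
  ⟨pullback.lift (specSpecial 𝔭 ≫ M.lift P) (𝟙 _)
    (by rw [Category.assoc, M.lift_str, Category.comp_id, Category.id_comp]),
    pullback.lift_snd _ _ _⟩

open Classical in
/-- The ideal, in the local ring of the model at the point `z`, of the closure of the point `x` of
the generic fibre; it is the unit ideal if `z` does not lie on this closure. -/
def closureIdeal (x : C.X) (z : M.X) : Ideal (M.X.presheaf.stalk z) :=
  if h : M.gen x ⤳ z then
    (IsLocalRing.maximalIdeal (M.X.presheaf.stalk (M.gen x))).comap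
      (M.X.presheaf.stalkSpecializes h).hom
  else ⊤

/-- The multiplicity at `y` of the intersection of the closure of `x` with the special fibre: the
length of the local ring of the special fibre at `y` modulo the ideal of the closure of `x`. -/
def mult (x : C.ClosedPoint) (y : M.special.ClosedPoint) : ℕ :=
  (Module.length (M.special.X.presheaf.stalk y.1)
    (M.special.X.presheaf.stalk y.1 ⧸
      (M.closureIdeal x.1 (M.inclSpecial y.1)).map (M.inclSpecial.stalkMap y.1).hom)).toNat

/-- `D'` is the specialization of the divisor `D`: the intersection with the special fibre of the
closure of `D` in the model. -/
def Specializes (D : C.Div) (D' : M.special.Div) : Prop :=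
  ∀ y, D' y = D.sum fun x n => n * (M.mult x y : ℤ)

/-- The graph of the reduction homomorphism `red_𝔭 : J(K) → J(k_𝔭)`, which sends the class of a
divisor of degree zero to the class of its specialization. As the model is regular and its special
fibre is an irreducible principal divisor, every class has exactly one reduction. -/
def redGraph : AddSubgroup (C.Jac × M.special.Jac) where
  carrier := {a | ∃ (D : C.Div0) (D' : M.special.Div0), M.Specializes D.1 D'.1 ∧
    C.cls D = a.1 ∧ M.special.cls D' = a.2}
  zero_mem' := ⟨0, 0, fun y => by simp, by simp, by simp⟩
  add_mem' := by
    rintro a a' ⟨D, D', h, h₁, h₂⟩ ⟨E, E', g, g₁, g₂⟩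
    refine ⟨D + E, D' + E', fun y => ?_, by simp [h₁, g₁], by simp [h₂, g₂]⟩
    have hs := Finsupp.sum_add_index' (f := D.1) (g := E.1)
      (h := fun x n => n * (M.mult x y : ℤ)) (fun _ => by simp) (fun _ _ _ => by ring)
    simp only [AddSubgroup.coe_add, Finsupp.add_apply, h y, g y, hs]
  neg_mem' := by
    rintro a ⟨D, D', h, h₁, h₂⟩
    refine ⟨-D, -D', fun y => ?_, by simp [h₁], by simp [h₂]⟩
    have hs := Finsupp.sum_neg_index (g := D.1)
      (h := fun x n => n * (M.mult x y : ℤ)) (fun _ => by simp)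
    simp only [AddSubgroup.coe_neg, Finsupp.neg_apply, h y, hs]
    simp [Finsupp.sum]

end GoodModel

/-! ### The projective line -/

/-- The projective line over `ℤ`. As `ℙ¹_S = ℙ¹ ×_ℤ S`, the `S`-morphisms `T ⟶ ℙ¹_S` of
`S`-schemes are the morphisms `T ⟶ ℙ¹`; in particular `ℙ¹(R)` is the set of morphisms
`Spec R ⟶ ℙ¹`. -/
def ProjLine : Scheme.{0} :=
  letI := MvPolynomial.gradedAlgebra (σ := Fin 2) (R := ℤ)
  Proj (MvPolynomial.homogeneousSubmodule (Fin 2) ℤ)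

theorem natCast_residue_eq_zero {p : ℕ} (𝔭 : PrimesAbove K p) :
    (p : ResField 𝔭.1) = 0 := by
  have h : (𝔭.1.valuation K) (p : K) < 1 := by
    have := (𝔭.1.valuation_lt_one_iff_mem (K := K) (p : 𝓞 K)).2 𝔭.2
    simpa using this
  have h' : (p : LocalInt 𝔭.1) ∈ IsLocalRing.maximalIdeal (LocalInt 𝔭.1) := by
    rw [ValuationSubring.valuation_lt_one_iff]
    exact (Valuation.isEquiv_valuation_valuationSubring (𝔭.1.valuation K)).lt_one_iff_lt_one.1
      (by simpa using h)
  have := (IsLocalRing.residue_eq_zero_iff (p : LocalInt 𝔭.1)).2 h'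
  simpa using this

/-- The inclusion `𝔽_p → k_𝔭` for `𝔭 ∣ p`. -/
def primeFieldHom {p : ℕ} (𝔭 : PrimesAbove K p) : ZMod p →+* ResField 𝔭.1 :=
  (Ideal.Quotient.lift (Ideal.span {(p : ℤ)}) (Int.castRingHom (ResField 𝔭.1)) (by
    intro a ha
    obtain ⟨c, rfl⟩ := Ideal.mem_span_singleton.1 ha
    simp [natCast_residue_eq_zero 𝔭])).comp
    (Int.quotientSpanNatEquivZMod p).symm.toRingHom

/-- The set `H` of the points of `C(K)` whose image under `ψ` lies in `ℙ¹(ℚ)`. -/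
def pointsOverRat (C : Curve K) (ψ : C.X ⟶ ProjLine) : Set C.Point :=
  {P | ∃ t : Spec (.of ℚ) ⟶ ProjLine,
    P.hom ≫ ψ = Spec.map (CommRingCat.ofHom (algebraMap ℚ K)) ≫ t}

/-! ### Reduction modulo a rational prime -/

section AtPrime

variable {C : Curve K} {p : ℕ} (M : ∀ 𝔭 : PrimesAbove K p, GoodModel C 𝔭.1)

/-- `∏_{𝔭 ∣ p} C(k_𝔭)`. -/
abbrev PointsMod : Type := ∀ 𝔭 : PrimesAbove K p, (M 𝔭).special.Point

/-- `∏_{𝔭 ∣ p} J(k_𝔭)`. -/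
abbrev JacMod : Type := ∀ 𝔭 : PrimesAbove K p, (M 𝔭).special.Jac

/-- The reduction map `red_p : C(K) → ∏_{𝔭 ∣ p} C(k_𝔭)`. -/
def redMod (P : C.Point) : PointsMod M := fun 𝔭 => (M 𝔭).redPoint P

/-- The residue class `ℬ_p(𝓟)`: the points of `C(K)` reducing to `𝓟`. -/
def residueClass (𝓟 : PointsMod M) : Set C.Point := {P | redMod M P = 𝓟}

/-- The graph of the reduction homomorphism `red_p : J(K) → ∏_{𝔭 ∣ p} J(k_𝔭)`. -/
def redGraphMod : AddSubgroup (C.Jac × JacMod M) where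
  carrier := {a | ∀ 𝔭, (a.1, a.2 𝔭) ∈ (M 𝔭).redGraph}
  zero_mem' := fun 𝔭 => (M 𝔭).redGraph.zero_mem
  add_mem' := fun ha hb 𝔭 => (M 𝔭).redGraph.add_mem (ha 𝔭) (hb 𝔭)
  neg_mem' := fun ha 𝔭 => (M 𝔭).redGraph.neg_mem (ha 𝔭)

/-- The Abel-Jacobi map `∏_{𝔭 ∣ p} C(k_𝔭) → ∏_{𝔭 ∣ p} J(k_𝔭)`, with the reductions of `Q` as base
points. -/
def abelJacobiMod (Q : C.Point) (𝓟 : PointsMod M) : JacMod M :=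
  fun 𝔭 => Curve.abelJacobi ((M 𝔭).redPoint Q) (𝓟 𝔭)

/-- The set `𝒢` of the `𝓟` in `∏_{𝔭 ∣ p} C(k_𝔭)` whose components all have the same image in
`ℙ¹(𝔽_p)` under the reductions of `ψ`; here `Ψ 𝔭` extends `ψ` to the model at `𝔭`. -/
def goodTuples (Ψ : ∀ 𝔭 : PrimesAbove K p, (M 𝔭).X ⟶ ProjLine) : Set (PointsMod M) :=
  {𝓟 | ∃ t : Spec (.of (ZMod p)) ⟶ ProjLine, ∀ 𝔭,
    (𝓟 𝔭).hom ≫ (M 𝔭).inclSpecial ≫ Ψ 𝔭 =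
      Spec.map (CommRingCat.ofHom (primeFieldHom 𝔭)) ≫ t}

end AtPrime

/-! ### The sieve -/

section Sieve

variable {A : Type} [AddCommGroup A] {b : ℕ} {B : Fin (b + 1) → Type}
  [∀ i, AddCommGroup (B i)] (L : AddSubgroup A) (Γ : ∀ i, AddSubgroup (A × B i))

/-- The groups `L_0 = L ∩ ker red_0` and `L_i = L_{i-1} ∩ ker red_i`, where `Γ i` is the graph of
the homomorphism `red_i : A → B i`. -/
def sieveSubgroup : Fin (b + 1) → AddSubgroup A :=
  Fin.induction (L ⊓ (Γ 0).comap (AddMonoidHom.inl A (B 0)))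
    fun i Li => Li ⊓ (Γ i.succ).comap (AddMonoidHom.inl A (B i.succ))

/-- The candidate sets `W_i ⊆ L / L_i`: `W_0` consists of the classes whose reduction is `z`, and
`W_i` of the classes of the `w + l` with `w` a representative of an element of `W_{i-1}` and
`l ∈ L_{i-1}` such that the reduction of `w + l` lies in `S i`. -/
def sieveSet (z : B 0) (S : ∀ i, Set (B i)) :
    ∀ i, Set (L ⧸ (sieveSubgroup L Γ i).addSubgroupOf L) :=
  Fin.induction
    {v | ∃ x : L, QuotientAddGroup.mk x = v ∧ ((x : A), z) ∈ Γ 0}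
    fun i Wi =>
      {v | ∃ w l : L, QuotientAddGroup.mk w ∈ Wi ∧ (l : A) ∈ sieveSubgroup L Γ i.castSucc ∧
        QuotientAddGroup.mk (w + l) = v ∧ ∃ y ∈ S i.succ, (((w + l : L) : A), y) ∈ Γ i.succ}

end Sieve

end

/-!
Suppose `P ∈ H` reduces to `𝓟` modulo `p₀`. The closure of a rational point in a proper
model is a section, so it meets the special fibre in a single point, its reduction, and does so
transversally. Hence the specialization of `[P - Q]` is the difference of the reductions of `P` and
`Q`: reduction commutes with the Abel-Jacobi map.

As `N` is prime to the orders of the groups `∏ J(k_𝔭)`, some multiple of `[P - Q]` by a multiple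
of `N` has the same reductions as `[P - Q]` modulo all `p_i`, and it lies in `L`. The reductions of
`P` lie in `𝒢_i`: since `ψ(P) ∈ ℙ¹(ℚ) = ℙ¹(ℤ_(p))`, and a point of the separated scheme `ℙ¹` over
the local ring at `𝔭` is determined by its generic fibre, all the `ψ(P)` modulo `𝔭 ∣ p` are images
of one point of `ℙ¹(𝔽_p)`. So the class of that multiple survives every step of the sieve.
-/

section GroupTheory

theorem exists_mem_forall_prod_mem_of_coprime {ι : Type*} [Finite ι] {A : Type*} {B : ι → Type*}
    [AddGroup A] [∀ i, AddGroup (B i)] {L : AddSubgroup A} {Γ : ∀ i, AddSubgroup (A × B i)} {N : ℕ}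
    (hN : ∀ a, N • a ∈ L) (hcop : ∀ i, (Nat.card (B i)).Coprime N) {a : A} {y : ∀ i, B i}
    (ha : ∀ i, (a, y i) ∈ Γ i) : ∃ w ∈ L, ∀ i, (w, y i) ∈ Γ i := by
  cases nonempty_fintype ι
  have h : (Nat.card (∀ i, B i)).Coprime N := by
    rw [Nat.card_pi]
    exact Nat.Coprime.prod_left fun i _ => hcop i
  let c : ℤ := (Nat.card (∀ i, B i)).gcdB N
  have hy : ∀ i, N • c • y i = y i := congrFun ((nsmulCoprime h).apply_symm_apply y)
  refine ⟨N • c • a, hN _, fun i => ?_⟩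
  have hmem := (Γ i).nsmul_mem ((Γ i).zsmul_mem (ha i) c) N
  rwa [Prod.smul_mk, Prod.smul_mk, hy] at hmem

variable {A : Type} [AddCommGroup A] {b : ℕ} {B : Fin (b + 1) → Type} [∀ i, AddCommGroup (B i)]
  {L : AddSubgroup A} {Γ : ∀ i, AddSubgroup (A × B i)} {y : ∀ i, B i} {S : ∀ i, Set (B i)}

theorem mk_mem_sieveSet (hS : ∀ i : Fin b, y i.succ ∈ S i.succ) {w : L}
    (hw : ∀ i, ((w : A), y i) ∈ Γ i) (i : Fin (b + 1)) :
    (w : L ⧸ (sieveSubgroup L Γ i).addSubgroupOf L) ∈ sieveSet L Γ (y 0) S i := by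
  induction i using Fin.induction with
  | zero => exact ⟨w, rfl, hw 0⟩
  | succ i ih =>
    refine ⟨w, 0, ih, zero_mem _, by rw [add_zero], y i.succ, hS i, ?_⟩
    rw [add_zero]
    exact hw i.succ

theorem sieveSet_nonempty {N : ℕ} (hN : ∀ a, N • a ∈ L)
    (hcop : ∀ i, (Nat.card (B i)).Coprime N) (hS : ∀ i : Fin b, y i.succ ∈ S i.succ) {a : A}
    (ha : ∀ i, (a, y i) ∈ Γ i) (i : Fin (b + 1)) : (sieveSet L Γ (y 0) S i).Nonempty := by
  obtain ⟨w, hwL, hw⟩ := exists_mem_forall_prod_mem_of_coprime hN hcop ha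
  exact ⟨_, mk_mem_sieveSet (w := ⟨w, hwL⟩) hS hw i⟩

end GroupTheory

section CommutativeAlgebra

theorem map_ker_eq_ker {O A B k : Type*} [CommRing O] [CommRing A] [CommRing B] [CommRing k]
    {α : O →+* A} {φ : A →+* O} (hαφ : φ.comp α = RingHom.id O)
    {q : A →+* B} (hq : Function.Surjective q) {r : O →+* k} {β : k →+* B}
    (hαβ : q.comp α = β.comp r) {ρ : B →+* k} (hφρ : ρ.comp q = r.comp φ) :
    (RingHom.ker φ).map q = RingHom.ker ρ := by
  refine le_antisymm (Ideal.map_le_iff_le_comap.2 fun a ha => ?_) fun g hg => ?_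
  · rw [RingHom.mem_ker] at ha
    rw [Ideal.mem_comap, RingHom.mem_ker, ← RingHom.comp_apply, hφρ, RingHom.comp_apply, ha,
      map_zero]
  · obtain ⟨a, rfl⟩ := hq g
    have hmem : a - α (φ a) ∈ RingHom.ker φ := by
      rw [RingHom.mem_ker, map_sub, ← RingHom.comp_apply φ α, hαφ, RingHom.id_apply, sub_self]
    have hzero : q (α (φ a)) = 0 := by
      rw [← RingHom.comp_apply q α, hαβ, RingHom.comp_apply, ← RingHom.comp_apply r φ, ← hφρ,
        RingHom.comp_apply, hg, map_zero]
    simpa only [map_sub, hzero, sub_zero] using Ideal.mem_map_of_mem q hmem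

theorem isUnit_intCast_of_isCoprime {S : Type*} [CommRing S] {p : ℕ} (hp : (p : S) = 0) {a : ℤ}
    (ha : IsCoprime a p) : IsUnit (a : S) := by
  have h := ha.map (Int.castRingHom S)
  rwa [map_natCast, hp, isCoprime_zero_right] at h

end CommutativeAlgebra

section IntLocal

variable (p : ℕ) [Fact p.Prime]

/-- The localization `ℤ_(p)` of `ℤ` at a prime number `p`, as a subring of `ℚ`. It is the common
source of the maps to `𝔽_p` and to the local rings of number fields at the primes above `p`. -/
noncomputable abbrev IntLocal : Subalgebra ℤ ℚ :=
  Localization.subalgebra.ofField ℚ (Ideal.span {(p : ℤ)}).primeCompl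
    (Ideal.primeCompl_le_nonZeroDivisors _)

namespace IntLocal

instance isDiscreteValuationRing : IsDiscreteValuationRing (IntLocal p) :=
  IsLocalization.AtPrime.isDiscreteValuationRing_of_dedekind_domain ℤ
    (P := Ideal.span {(p : ℤ)}) (by simpa using (Fact.out : p.Prime).ne_zero) (IntLocal p)

variable {p}

instance subsingleton_ringHom {S : Type*} [CommRing S] : Subsingleton (IntLocal p →+* S) :=
  ⟨fun _ _ => IsLocalization.ringHom_ext (Ideal.span {(p : ℤ)}).primeCompl
    (Subsingleton.elim _ _)⟩

theorem nonempty_ringHom {S : Type*} [CommRing S] (h : ∀ a : ℤ, IsCoprime a p → IsUnit (a : S)) :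
    Nonempty (IntLocal p →+* S) :=
  ⟨IsLocalization.lift (M := (Ideal.span {(p : ℤ)}).primeCompl) (g := Int.castRingHom S)
    fun a => h a <| .symm <| (Nat.prime_iff_prime_int.1 Fact.out).coprime_iff_not_dvd.2 fun hdvd =>
      a.2 (Ideal.mem_span_singleton.2 hdvd)⟩

end IntLocal

end IntLocal

universe u

section Schemes

theorem exists_map_fromSpecStalk_eq {X : Scheme.{u}} {R : CommRingCat.{u}} [IsLocalRing R]
    (s : Spec R ⟶ X) {z : X} (hz : s (IsLocalRing.closedPoint R) = z) :
    ∃ φ : X.presheaf.stalk z ⟶ R, IsLocalHom φ.hom ∧ Spec.map φ ≫ X.fromSpecStalk z = s := by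
  subst hz
  exact ⟨Scheme.stalkClosedPointTo s, inferInstance, Scheme.Spec_stalkClosedPointTo_fromSpecStalk s⟩

theorem isDominant_specMap_of_injective {R S : Type u} [CommRing R] [CommRing S] {f : R →+* S}
    (hf : Function.Injective f) : IsDominant (Spec.map (CommRingCat.ofHom f)) where
  denseRange := (PrimeSpectrum.denseRange_comap_iff_ker_le_nilRadical f).2 <| by
    rw [(RingHom.injective_iff_ker_eq_bot f).1 hf]
    exact bot_le

theorem specMap_cancel_of_injective {R S : Type u} [CommRing R] [IsReduced R] [CommRing S]
    {f : R →+* S} (hf : Function.Injective f) {Y : Scheme.{u}} [Y.IsSeparated]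
    {s t : Spec (.of R) ⟶ Y}
    (h : Spec.map (CommRingCat.ofHom f) ≫ s = Spec.map (CommRingCat.ofHom f) ≫ t) : s = t :=
  have := isDominant_specMap_of_injective hf
  ext_of_isDominant (Spec.map (CommRingCat.ofHom f)) h

end Schemes

section ProjectiveSpace

attribute [local instance] MvPolynomial.gradedAlgebra

variable {σ : Type*}

theorem algebraMap_homogeneousSubmodule_zero_surjective {R : Type*} [CommRing R] :
    Function.Surjective (algebraMap R (MvPolynomial.homogeneousSubmodule σ R 0)) := by
  rintro ⟨a, ha⟩
  rw [MvPolynomial.homogeneousSubmodule_zero, Submodule.mem_one] at ha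
  obtain ⟨r, hr⟩ := ha
  exact ⟨r, Subtype.ext hr⟩

theorem finiteType_homogeneousSubmodule_zero [Finite σ] {R : Type*} [CommRing R] :
    Algebra.FiniteType (MvPolynomial.homogeneousSubmodule σ R 0) (MvPolynomial σ R) :=
  have : IsScalarTower R (MvPolynomial.homogeneousSubmodule σ R 0) (MvPolynomial σ R) :=
    .of_algebraMap_eq (R := R) (S := MvPolynomial.homogeneousSubmodule σ R 0) fun _ => rfl
  .of_restrictScalars_finiteType R _ _

theorem exists_proj_extension_of_valuationRing {σ : Type u} [Finite σ] {R F : Type u} [CommRing R]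
    [IsDomain R] [ValuationRing R] [Field F] [Algebra R F] [IsFractionRing R F]
    (t : Spec (.of F) ⟶ Proj (MvPolynomial.homogeneousSubmodule σ ℤ)) :
    ∃ t' : Spec (.of R) ⟶ Proj (MvPolynomial.homogeneousSubmodule σ ℤ),
      Spec.map (CommRingCat.ofHom (algebraMap R F)) ≫ t' = t := by
  let 𝒜 := MvPolynomial.homogeneousSubmodule σ ℤ
  have : Algebra.FiniteType (𝒜 0) (MvPolynomial σ ℤ) := finiteType_homogeneousSubmodule_zero
  let c : 𝒜 0 →+* R := (Int.castRingHom R).comp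
    (MvPolynomial.constantCoeff.comp (algebraMap (𝒜 0) (MvPolynomial σ ℤ)))
  obtain ⟨a, ha⟩ := Spec.map_surjective (t ≫ Proj.toSpecZero 𝒜)
  have hac : a = CommRingCat.ofHom c ≫ CommRingCat.ofHom (algebraMap R F) := by
    ext x
    obtain ⟨n, rfl⟩ := algebraMap_homogeneousSubmodule_zero_surjective x
    simp
  have hsq : CommSq t (Spec.map (CommRingCat.ofHom (algebraMap R F))) (Proj.toSpecZero 𝒜)
      (Spec.map (CommRingCat.ofHom c)) :=
    ⟨by rw [← ha, hac, Spec.map_comp]⟩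
  obtain ⟨⟨t', ht', -⟩⟩ := (Proj.valuativeCriterion_existence 𝒜
    { R := R, K := F, i₁ := t, i₂ := _, commSq := hsq }).exists_lift
  exact ⟨t', ht'⟩

namespace ProjLine

instance isSeparated : ProjLine.IsSeparated :=
  inferInstanceAs (Proj (MvPolynomial.homogeneousSubmodule (Fin 2) ℤ)).IsSeparated

theorem exists_extension_intLocal {p : ℕ} [Fact p.Prime] (t : Spec (.of ℚ) ⟶ ProjLine) :
    ∃ t' : Spec (.of (IntLocal p)) ⟶ ProjLine,
      Spec.map (CommRingCat.ofHom (algebraMap (IntLocal p) ℚ)) ≫ t' = t :=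
  exists_proj_extension_of_valuationRing (σ := Fin 2) t

end ProjLine

end ProjectiveSpace

section Reduction

open NumberField IsDedekindDomain

variable {K : Type} [Field K] [NumberField K]

theorem isUnit_intCast_localInt {p : ℕ} (𝔭 : PrimesAbove K p) {a : ℤ} (ha : IsCoprime a p) :
    IsUnit (a : LocalInt 𝔭.1) := by
  rw [← IsLocalRing.residue_ne_zero_iff_isUnit, map_intCast]
  exact (isUnit_intCast_of_isCoprime (natCast_residue_eq_zero 𝔭) ha).ne_zero

namespace GoodModel

section Sections

variable {C : Curve K} {𝔭 : HeightOneSpectrum (𝓞 K)} (M : GoodModel C 𝔭)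

theorem specGeneric_lift (P : C.Point) : specGeneric 𝔭 ≫ M.lift P = P.hom ≫ M.gen :=
  (M.exists_lift P).choose_spec.1

theorem redPoint_inclSpecial (P : C.Point) :
    (M.redPoint P).hom ≫ M.inclSpecial = specSpecial 𝔭 ≫ M.lift P :=
  pullback.lift_fst _ _ _

theorem inclSpecial_str : M.inclSpecial ≫ M.str = M.special.str ≫ specSpecial 𝔭 :=
  pullback.condition

instance isClosedImmersion_inclSpecial : IsClosedImmersion M.inclSpecial :=
  have : IsClosedImmersion (specSpecial 𝔭) :=
    IsClosedImmersion.spec_of_surjective _ IsLocalRing.residue_surjective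
  inferInstanceAs (IsClosedImmersion (pullback.fst M.str (specSpecial 𝔭)))

instance isClosedImmersion_lift (P : C.Point) : IsClosedImmersion (M.lift P) :=
  have : IsClosedImmersion (M.lift P ≫ M.str) := by rw [M.lift_str]; infer_instance
  IsClosedImmersion.of_comp (M.lift P) M.str

theorem lift_comp_eq {Y : Scheme.{0}} [Y.IsSeparated] {Ψ : M.X ⟶ Y} {P : C.Point}
    {s : Spec (.of (LocalInt 𝔭)) ⟶ Y} (h : P.hom ≫ M.gen ≫ Ψ = specGeneric 𝔭 ≫ s) :
    M.lift P ≫ Ψ = s :=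
  specMap_cancel_of_injective (IsFractionRing.injective (LocalInt 𝔭) K) <| by
    rw [← Category.assoc, M.specGeneric_lift, Category.assoc, h]

end Sections

theorem redMod_mem_goodTuples {C : Curve K} {p : ℕ} (hp : p.Prime)
    {M : ∀ 𝔭 : PrimesAbove K p, GoodModel C 𝔭.1} {ψ : C.X ⟶ ProjLine}
    {Ψ : ∀ 𝔭 : PrimesAbove K p, (M 𝔭).X ⟶ ProjLine} (hΨ : ∀ 𝔭, (M 𝔭).gen ≫ Ψ 𝔭 = ψ)
    {P : C.Point} (hP : P ∈ pointsOverRat C ψ) : redMod M P ∈ goodTuples M Ψ := by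
  have := Fact.mk hp
  obtain ⟨t, ht⟩ := hP
  obtain ⟨t', rfl⟩ := ProjLine.exists_extension_intLocal (p := p) t
  obtain ⟨r⟩ : Nonempty (IntLocal p →+* ZMod p) :=
    IntLocal.nonempty_ringHom fun _ => isUnit_intCast_of_isCoprime (CharP.cast_eq_zero _ p)
  refine ⟨Spec.map (CommRingCat.ofHom r) ≫ t', fun 𝔭 => ?_⟩
  obtain ⟨e⟩ : Nonempty (IntLocal p →+* LocalInt 𝔭.1) :=
    IntLocal.nonempty_ringHom fun _ => isUnit_intCast_localInt 𝔭
  have hgen : (algebraMap ℚ K).comp (algebraMap (IntLocal p) ℚ) =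
      (algebraMap (LocalInt 𝔭.1) K).comp e := Subsingleton.elim _ _
  have hspecial : (IsLocalRing.residue (LocalInt 𝔭.1)).comp e = (primeFieldHom 𝔭).comp r :=
    Subsingleton.elim _ _
  have hlift : (M 𝔭).lift P ≫ Ψ 𝔭 = Spec.map (CommRingCat.ofHom e) ≫ t' :=
    (M 𝔭).lift_comp_eq <| by
      rw [hΨ, ht, ← Spec.map_comp_assoc, ← Spec.map_comp_assoc, ← CommRingCat.ofHom_comp,
        ← CommRingCat.ofHom_comp, hgen]
  calc ((M 𝔭).redPoint P).hom ≫ (M 𝔭).inclSpecial ≫ Ψ 𝔭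
      = specSpecial 𝔭.1 ≫ (M 𝔭).lift P ≫ Ψ 𝔭 := by
        rw [← Category.assoc, (M 𝔭).redPoint_inclSpecial, Category.assoc]
    _ = Spec.map (CommRingCat.ofHom (primeFieldHom 𝔭)) ≫ Spec.map (CommRingCat.ofHom r) ≫ t' := by
        rw [hlift, ← Spec.map_comp_assoc, ← Spec.map_comp_assoc, ← CommRingCat.ofHom_comp,
          ← CommRingCat.ofHom_comp, hspecial]

section Specialization

variable {C : Curve K} {𝔭 : HeightOneSpectrum (𝓞 K)} (M : GoodModel C 𝔭) (P : C.Point)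

theorem specSpecial_apply (x : Spec (.of (ResField 𝔭))) :
    specSpecial 𝔭 x = IsLocalRing.closedPoint (LocalInt 𝔭) := by
  rw [Subsingleton.elim (α := PrimeSpectrum (ResField 𝔭)) x (IsLocalRing.closedPoint _)]
  exact IsLocalRing.comap_closedPoint (IsLocalRing.residue (LocalInt 𝔭))

theorem gen_toClosedPoint :
    M.gen P.toClosedPoint.1 = M.lift P (specGeneric 𝔭 (IsLocalRing.closedPoint K)) :=
  (congr($(M.specGeneric_lift P) (IsLocalRing.closedPoint K))).symm

theorem inclSpecial_redPoint :
    M.inclSpecial (M.redPoint P).toClosedPoint.1 =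
      M.lift P (IsLocalRing.closedPoint (LocalInt 𝔭)) :=
  (congr($(M.redPoint_inclSpecial P) (IsLocalRing.closedPoint (ResField 𝔭)))).trans
    (congrArg (M.lift P) (specSpecial_apply _))

theorem str_inclSpecial (y : M.special.X) :
    M.str (M.inclSpecial y) = IsLocalRing.closedPoint (LocalInt 𝔭) :=
  (congr($(M.inclSpecial_str) y)).trans (specSpecial_apply _)

theorem specializes_redPoint :
    M.gen P.toClosedPoint.1 ⤳ M.inclSpecial (M.redPoint P).toClosedPoint.1 := by
  rw [gen_toClosedPoint, inclSpecial_redPoint]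
  exact (IsLocalRing.specializes_closedPoint (R := LocalInt 𝔭) _).map (M.lift P).continuous

variable {M P} in
theorem eq_redPoint_of_specializes {y : M.special.ClosedPoint}
    (h : M.gen P.toClosedPoint.1 ⤳ M.inclSpecial y.1) : y = (M.redPoint P).toClosedPoint := by
  obtain ⟨r, hr⟩ : M.inclSpecial y.1 ∈ Set.range (M.lift P) :=
    h.mem_closed (M.lift P).isClosedEmbedding.isClosed_range ⟨_, (M.gen_toClosedPoint P).symm⟩
  have hr_closed : r = IsLocalRing.closedPoint (LocalInt 𝔭) := by
    have hstr : M.str (M.lift P r) = r := congr($(M.lift_str P) r)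
    rw [← hstr, hr, M.str_inclSpecial]
  refine Subtype.ext (M.inclSpecial.isClosedEmbedding.injective ?_)
  rw [inclSpecial_redPoint, ← hr, hr_closed]

variable {M P} in
theorem closureIdeal_eq_ker {z : M.X} (h : M.gen P.toClosedPoint.1 ⤳ z)
    {φ : M.X.presheaf.stalk z ⟶ CommRingCat.of (LocalInt 𝔭)}
    (hφ : Spec.map φ ≫ M.X.fromSpecStalk z = M.lift P) :
    M.closureIdeal P.toClosedPoint.1 z = RingHom.ker φ.hom := by
  have hpoint : Spec.map (M.X.presheaf.stalkSpecializes h) (IsLocalRing.closedPoint _) =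
      Spec.map φ (specGeneric 𝔭 (IsLocalRing.closedPoint K)) := by
    have hclosed : (Spec.map (M.X.presheaf.stalkSpecializes h) ≫ M.X.fromSpecStalk z)
        (IsLocalRing.closedPoint _) = M.gen P.toClosedPoint.1 := by
      rw [Scheme.SpecMap_stalkSpecializes_fromSpecStalk]
      exact Scheme.fromSpecStalk_closedPoint
    have hgeneric : (Spec.map φ ≫ M.X.fromSpecStalk z)
        (specGeneric 𝔭 (IsLocalRing.closedPoint K)) = M.gen P.toClosedPoint.1 := by
      rw [hφ, M.gen_toClosedPoint]
    exact (M.X.fromSpecStalk z).isEmbedding.injective (hclosed.trans hgeneric.symm)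
  rw [closureIdeal, dif_pos h]
  refine congr(($hpoint).asIdeal).trans ?_
  ext a
  change algebraMap (LocalInt 𝔭) K (φ.hom a) ∈ IsLocalRing.maximalIdeal K ↔ φ.hom a = 0
  rw [IsLocalRing.maximalIdeal_eq_bot, Ideal.mem_bot,
    map_eq_zero_iff _ (IsFractionRing.injective (LocalInt 𝔭) K)]

theorem map_closureIdeal_redPoint :
    (M.closureIdeal P.toClosedPoint.1 (M.inclSpecial (M.redPoint P).toClosedPoint.1)).map
      (M.inclSpecial.stalkMap (M.redPoint P).toClosedPoint.1).hom =
    IsLocalRing.maximalIdeal (M.special.X.presheaf.stalk (M.redPoint P).toClosedPoint.1) := by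
  obtain ⟨φ, -, hφ⟩ := exists_map_fromSpecStalk_eq (R := .of (LocalInt 𝔭)) (M.lift P)
    (M.inclSpecial_redPoint P).symm
  obtain ⟨ρ, _, hρ⟩ := exists_map_fromSpecStalk_eq (R := .of (ResField 𝔭)) (M.redPoint P).hom
    (z := (M.redPoint P).toClosedPoint.1) rfl
  rw [closureIdeal_eq_ker (M.specializes_redPoint P) hφ]
  generalize (M.redPoint P).toClosedPoint.1 = y at *
  -- With the structure maps `α` and `β` of the two local rings, `φ` becomes a retraction of `α`
  -- lifting the retraction `ρ` of `β`, so that the kernel of `φ` generates that of `ρ`.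
  obtain ⟨α, hα⟩ := Spec.map_surjective (M.X.fromSpecStalk (M.inclSpecial y) ≫ M.str)
  obtain ⟨β, hβ⟩ := Spec.map_surjective (M.special.X.fromSpecStalk y ≫ M.special.str)
  have hαφ : α ≫ φ = 𝟙 _ := by
    apply Spec.map_injective
    rw [Spec.map_comp, hα, reassoc_of% hφ, M.lift_str, Spec.map_id]
  have hαβ : α ≫ M.inclSpecial.stalkMap y =
      CommRingCat.ofHom (IsLocalRing.residue (LocalInt 𝔭)) ≫ β := by
    apply Spec.map_injective
    rw [Spec.map_comp, Spec.map_comp, hα, hβ, ← Category.assoc,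
      Scheme.SpecMap_stalkMap_fromSpecStalk, Category.assoc, Category.assoc, M.inclSpecial_str]
  have hφρ : M.inclSpecial.stalkMap y ≫ ρ =
      φ ≫ CommRingCat.ofHom (IsLocalRing.residue (LocalInt 𝔭)) := by
    apply Spec.map_injective
    rw [← cancel_mono (M.X.fromSpecStalk (M.inclSpecial y)), Spec.map_comp, Spec.map_comp,
      Category.assoc, Category.assoc, hφ, Scheme.SpecMap_stalkMap_fromSpecStalk, reassoc_of% hρ,
      M.redPoint_inclSpecial]
  calc (RingHom.ker φ.hom).map (M.inclSpecial.stalkMap y).hom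
      = RingHom.ker ρ.hom :=
        map_ker_eq_ker congr(($hαφ).hom) (M.inclSpecial.stalkMap_surjective y)
          congr(($hαβ).hom) congr(($hφρ).hom)
    _ = IsLocalRing.maximalIdeal _ := by
        rw [RingHom.ker_eq_comap_bot, ← IsLocalRing.maximalIdeal_eq_bot]
        exact IsLocalRing.maximalIdeal_comap ρ.hom

variable {M P} in
theorem mult_toClosedPoint_eq_zero {y : M.special.ClosedPoint}
    (hy : y ≠ (M.redPoint P).toClosedPoint) : M.mult P.toClosedPoint y = 0 := by
  rw [mult, closureIdeal, dif_neg fun h => hy (eq_redPoint_of_specializes h), Ideal.map_top,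
    Module.length_eq_zero_iff.2 (Submodule.Quotient.subsingleton_iff.2 rfl), ENat.toNat_zero]

theorem mult_toClosedPoint_redPoint :
    M.mult P.toClosedPoint (M.redPoint P).toClosedPoint = 1 := by
  rw [mult, map_closureIdeal_redPoint]
  have hsimple := isSimpleModule_iff_isCoatom.2 (IsLocalRing.maximalIdeal.isMaximal
    (M.special.X.presheaf.stalk (M.redPoint P).toClosedPoint.1)).out
  rw [Module.length_eq_one, ENat.toNat_one]

theorem abelJacobi_mem_redGraph (Q : C.Point) :
    (Curve.abelJacobi Q P, Curve.abelJacobi (M.redPoint Q) (M.redPoint P)) ∈ M.redGraph := by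
  classical
  have hmult (R : C.Point) (y) :
      M.mult R.toClosedPoint y = if y = (M.redPoint R).toClosedPoint then 1 else 0 := by
    split_ifs with hy
    · rw [hy, mult_toClosedPoint_redPoint]
    · exact mult_toClosedPoint_eq_zero hy
  refine ⟨_, _, fun y => ?_, rfl, rfl⟩
  rw [Finsupp.sum_sub_index (h := fun x n => n * (M.mult x y : ℤ)) fun _ _ _ => by ring]
  simp [hmult, Finsupp.single_apply, eq_comm]

end Specialization

end GoodModel

theorem mainTheorem5_general (C : Curve K) (Q : C.Point) (ψ : C.X ⟶ ProjLine)
    (L : AddSubgroup C.Jac) (N : ℕ) (hN : ∀ x : C.Jac, N • x ∈ L)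
    (b : ℕ) (p : Fin (b + 1) → ℕ) (hp : ∀ i, (p i).Prime)
    (M : ∀ i, ∀ 𝔭 : PrimesAbove K (p i), GoodModel C 𝔭.1)
    (Ψ : ∀ i, ∀ 𝔭 : PrimesAbove K (p i), (M i 𝔭).X ⟶ ProjLine)
    (hΨ : ∀ i 𝔭, (M i 𝔭).gen ≫ Ψ i 𝔭 = ψ)
    (hcop : ∀ i, Nat.Coprime (Nat.card (JacMod (M i))) N)
    (𝓟 : PointsMod (M 0))
    (hW : sieveSet L (fun i => redGraphMod (M i)) (abelJacobiMod (M 0) Q 𝓟)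
      (fun i => abelJacobiMod (M i) Q '' goodTuples (M i) (Ψ i)) (Fin.last b) = ∅) :
    residueClass (M 0) 𝓟 ∩ pointsOverRat C ψ = ∅ := by
  rw [Set.eq_empty_iff_forall_notMem]
  rintro P ⟨rfl, hP⟩
  have hred : ∀ i, (Curve.abelJacobi Q P, abelJacobiMod (M i) Q (redMod (M i) P)) ∈
      redGraphMod (M i) :=
    fun i 𝔭 => (M i 𝔭).abelJacobi_mem_redGraph P Q
  have hgood : ∀ i, redMod (M i) P ∈ goodTuples (M i) (Ψ i) :=
    fun i => GoodModel.redMod_mem_goodTuples (hp i) (hΨ i) hP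
  exact (sieveSet_nonempty (Γ := fun i => redGraphMod (M i))
    (y := fun i => abelJacobiMod (M i) Q (redMod (M i) P)) hN hcop
    (fun i => Set.mem_image_of_mem _ (hgood i.succ)) hred (Fin.last b)).ne_empty hW

end Reduction

theorem mainTheorem5 {K : Type} [Field K] [NumberField K]
    (C : Curve K) (Q : C.Point) (ψ : C.X ⟶ ProjLine)
    (L : AddSubgroup C.Jac) (N : ℕ) (hN : N ≠ 0) (hL : L.index = N)
    (b : ℕ) (p : Fin (b + 1) → ℕ) (hp : ∀ i, (p i).Prime)
    (hunram : ∀ i, ∀ 𝔭 : PrimesAbove K (p i), 𝔭.1.asIdeal.ramificationIdx ℤ = 1)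
    (M : ∀ i, ∀ 𝔭 : PrimesAbove K (p i), GoodModel C 𝔭.1)
    (Ψ : ∀ i, ∀ 𝔭 : PrimesAbove K (p i), (M i 𝔭).X ⟶ ProjLine)
    (hΨ : ∀ i 𝔭, (M i 𝔭).gen ≫ Ψ i 𝔭 = ψ)
    (hcop : ∀ i, Nat.Coprime (Nat.card (JacMod (M i))) N)
    (𝓟 : PointsMod (M 0)) (h𝓟 : 𝓟 ∈ goodTuples (M 0) (Ψ 0))
    (hW : sieveSet L (fun i => redGraphMod (M i)) (abelJacobiMod (M 0) Q 𝓟)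
      (fun i => abelJacobiMod (M i) Q '' goodTuples (M i) (Ψ i)) (Fin.last b) = ∅) :
    residueClass (M 0) 𝓟 ∩ pointsOverRat C ψ = ∅ :=
  mainTheorem5_general C Q ψ L N (fun x => hL ▸ L.nsmul_index_mem x) b p hp M Ψ hΨ hcop 𝓟 hW
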